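/- Identify $\mathbb{C}^2$ with $\mathbb{R}^4$ via $\langle z,w\rangle=\mathrm{Re}(z^1\bar w^1+z^2\bar w^2)$, let $S^3\subset\mathbb{C}^2$ be the unit sphere, $\xi(z)=iz$ its Reeb field, and $\delta_z=\{v\in T_zS^3:\langle\xi(z),v\rangle=0\}$ the contact distribution. Let $\varphi:S\to S^3$ be a smooth minimal immersion of a smooth surface, with the induced metric on $S$; tangent vectors of $S$ are identified with their images under $d\varphi$. On an open set $W\subset S$ let $e_1$ be a characteristic field, i.e. a smooth unit vector field in $TS\cap\delta$, and let $\beta:W\to\mathbb{R}$ be a smooth contact angle, i.e. a smooth function such that $$e_2=\sin\beta\, (i e_1)+\cos\beta\,\xi$$ is tangent to $S$. (Then $(e_1,e_2)$ is an orthonormal tangent frame, $\cos\beta=\langle\xi,e_2\rangle$, $e_3=-\cos\beta\,(ie_1)+\sin\beta\,\xi$ is a unit normal, and $\sin\beta=\langle \xi,e_3\rangle$, so $\beta$ is complementary to the angle between the normals of $\delta$ and of $TS$.) Then on $W$ the Gaussian curvature $K$ of the induced metric satisfies $$K=1-|\nabla\beta+e_1|^2,$$ and at every point of $W$ where $\cos\beta\neq0$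 (equivalently, where $TS\neq\delta$) the Laplacian of $\beta$ satisfies $$\Delta\beta=-\tan\beta\,\bigl((\beta_1+2)^2+\beta_2^2\bigr)=-\tan\beta\,|\nabla\beta+2e_1|^2,\qquad \beta_i=d\beta(e_i).$$ -/

import Mathlib

open scoped Manifold ContDiff

noncomputable section

namespace ContactSurface

/-- Coordinate plane on which surfaces are modelled. -/
abbrev Plane := EuclideanSpace ℝ (Fin 2)

/-- `ℂ²`; its real inner product `inner ℝ z w` is the real part of the standard Hermitian
product, and its norm is the Euclidean norm. The sphere `S³` is `Metric.sphere (0 : C2) 1`. -/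
abbrev C2 := EuclideanSpace ℂ (Fin 2)

/-! ### Riemannian geometry of a parametrized surface `x : Plane → ℂ²` -/

/-- Partial derivative `∂ᵢ f` at `u`. -/
def pd {F : Type*} [NormedAddCommGroup F] [NormedSpace ℝ F] (i : Fin 2) (f : Plane → F)
    (u : Plane) : F :=
  fderiv ℝ f u (EuclideanSpace.single i (1 : ℝ))

/-- First fundamental form `gᵢⱼ = ⟨∂ᵢ x, ∂ⱼ x⟩`. -/
def metric (x : Plane → C2) (u : Plane) : Matrix (Fin 2) (Fin 2) ℝ :=
  Matrix.of fun i j => inner ℝ (pd i x u) (pd j x u)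

/-- Christoffel symbols `Γᵏᵢⱼ` of the Levi-Civita connection of the induced metric. -/
def christoffel (x : Plane → C2) (k i j : Fin 2) (u : Plane) : ℝ :=
  (1 / 2) * ∑ l, (metric x u)⁻¹ k l *
    (pd i (fun w => metric x w j l) u + pd j (fun w => metric x w i l) u
      - pd l (fun w => metric x w i j) u)

/-- Components `Rˡ` of the curvature tensor, `R(∂ᵢ, ∂ⱼ) ∂ₖ = ∑ₗ Rˡ ∂ₗ`, where
`R(X, Y) = ∇_X ∇_Y - ∇_Y ∇_X - ∇_[X,Y]`. -/
def riemann (x : Plane → C2) (l i j k : Fin 2) (u : Plane) : ℝ :=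
  pd i (christoffel x l j k) u - pd j (christoffel x l i k) u
    + ∑ m, (christoffel x l i m u * christoffel x m j k u
      - christoffel x l j m u * christoffel x m i k u)

/-- Intrinsic Gaussian curvature `⟨R(∂₀, ∂₁) ∂₁, ∂₀⟩ / det g` of the induced metric. -/
def localGaussCurvature (x : Plane → C2) (u : Plane) : ℝ :=
  (∑ l, riemann x l 0 1 1 u * metric x u l 0) / (metric x u).det

/-- Gradient of `f` for the induced metric, as a vector of `ℂ²` tangent to the surface:
`∑ gⁱʲ (∂ⱼ f) ∂ᵢ x`. -/
def localGrad (x : Plane → C2) (f : Plane → ℝ) (u : Plane) : C2 :=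
  ∑ i, ∑ j, ((metric x u)⁻¹ i j * pd j f u) • pd i x u

/-- Laplace-Beltrami operator of the induced metric (trace of the Hessian):
`∑ gⁱʲ (∂ᵢ ∂ⱼ f - ∑ Γᵏᵢⱼ ∂ₖ f)`. -/
def localLaplacian (x : Plane → C2) (f : Plane → ℝ) (u : Plane) : ℝ :=
  ∑ i, ∑ j, (metric x u)⁻¹ i j * (pd i (pd j f) u - ∑ k, christoffel x k i j u * pd k f u)

/-- Mean curvature in the direction of a normal vector `ν`: half the trace of the second
fundamental form `⟨∂ᵢ ∂ⱼ x, ν⟩`. -/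
def localMeanCurvature (x : Plane → C2) (ν : C2) (u : Plane) : ℝ :=
  (1 / 2) * ∑ i, ∑ j, (metric x u)⁻¹ i j * inner ℝ (pd i (pd j x) u) ν

/-! ### Surfaces in `S³` -/

variable {S : Type*} [TopologicalSpace S] [ChartedSpace Plane S]

/-- Gaussian curvature at `p` of the metric induced by `φ`, computed in the chart `c`. -/
def gaussCurvature (φ : S → C2) (c : OpenPartialHomeomorph S Plane) (p : S) : ℝ :=
  localGaussCurvature (φ ∘ c.symm) (c p)

/-- Gradient at `p` of `f` for the metric induced by `φ`, computed in the chart `c` and viewed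
in `ℂ²` through the differential of `φ`. -/
def grad (φ : S → C2) (c : OpenPartialHomeomorph S Plane) (f : S → ℝ) (p : S) : C2 :=
  localGrad (φ ∘ c.symm) (f ∘ c.symm) (c p)

/-- Laplacian at `p` of `f` for the metric induced by `φ`, computed in the chart `c`. -/
def laplacian (φ : S → C2) (c : OpenPartialHomeomorph S Plane) (f : S → ℝ) (p : S) : ℝ :=
  localLaplacian (φ ∘ c.symm) (f ∘ c.symm) (c p)

/-- The differential `df(v)` of a real function `f` on `S` at `p`. -/
def differential (f : S → ℝ) (p : S) (v : TangentSpace (𝓡 2) p) : ℝ :=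
  mfderiv (𝓡 2) 𝓘(ℝ, ℝ) f p v

/-- The tangent plane of the immersed surface, as a set of vectors of `ℂ²`. -/
def tangentPlane (φ : S → C2) (p : S) : Set C2 :=
  Set.range (mfderiv (𝓡 2) 𝓘(ℝ, C2) φ p)

/-- `φ` is a smooth immersion of the surface `S` into the unit sphere `S³ ⊂ ℂ²`. -/
structure IsSphereImmersion (φ : S → C2) : Prop where
  smooth : ContMDiff (𝓡 2) 𝓘(ℝ, C2) ∞ φ
  mem_sphere : ∀ p, φ p ∈ Metric.sphere (0 : C2) 1
  injective_mfderiv : ∀ p, Function.Injective (mfderiv (𝓡 2) 𝓘(ℝ, C2) φ p)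

/-- The surface is minimal in `S³`: its mean curvature vanishes at every point, in every smooth
chart, for every vector `ν` that is tangent to `S³` and normal to the surface. -/
def IsMinimal (φ : S → C2) : Prop :=
  ∀ c ∈ IsManifold.maximalAtlas (𝓡 2) ∞ S, ∀ p ∈ c.source, ∀ ν : C2,
    inner ℝ (φ p) ν = 0 → (∀ t ∈ tangentPlane φ p, inner ℝ t ν = 0) →
      localMeanCurvature (φ ∘ c.symm) ν (c p) = 0

/-! ### Contact geometry -/

/-- The Reeb field `ξ(z) = i z`. -/
def reeb (z : C2) : C2 := Complex.I • z

/-- The contact distribution of `S³`: the orthogonal complement of `ξ(z)` in `T_z S³`. -/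
def contactDistribution (z : C2) : Set C2 :=
  {v | inner ℝ z v = 0 ∧ inner ℝ (reeb z) v = 0}

/-- Over `W ⊆ S`, `e₁` is a characteristic field (a smooth unit field in `TS ∩ δ`), and `β` is the
smooth contact angle for the tangent frame `(e₁, e₂)`: with `f₁ = e₁`, `f₂ = i e₁`, `f₃ = ξ` (an
orthonormal frame of `S³`), `e₂ = sin β f₂ + cos β f₃` is tangent to the surface. Hence
`e₃ = -cos β f₂ + sin β f₃` is a unit normal of the surface, `cos β = ⟨ξ, e₂⟩` and
`sin β = ⟨ξ, e₃⟩`: `β` is complementary to the angle between the normals `ξ` of `δ` and `e₃`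
of `TS`. -/
structure IsContactFrameOn (φ : S → C2) (e₁ e₂ : S → C2) (β : S → ℝ) (W : Set S) : Prop where
  smooth_field : ContMDiffOn (𝓡 2) 𝓘(ℝ, C2) ∞ e₁ W
  smooth_angle : ContMDiffOn (𝓡 2) 𝓘(ℝ, ℝ) ∞ β W
  norm_field : ∀ p ∈ W, ‖e₁ p‖ = 1
  field_tangent : ∀ p ∈ W, e₁ p ∈ tangentPlane φ p
  field_contact : ∀ p ∈ W, e₁ p ∈ contactDistribution (φ p)
  second_eq : ∀ p ∈ W,
    e₂ p = Real.sin (β p) • (Complex.I • e₁ p) + Real.cos (β p) • reeb (φ p)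
  second_tangent : ∀ p ∈ W, e₂ p ∈ tangentPlane φ p

end ContactSurface

end

/-!
In a chart, the immersion becomes a parametrization `x` of a surface in `ℂ²`, and
`e₁`, `e₂ = sin β (i e₁) + cos β (i x)`, `e₃ = -cos β (i e₁) + sin β (i x)` together with `x` itself
form an orthonormal frame of `ℂ² = ℝ⁴` along it. The argument is the method of moving frames with
the coframe `θₐ = ⟨dx, eₐ⟩` and the connection forms `ω_ab = ⟨deₐ, e_b⟩`.

The contact structure determines the connection. Since multiplication by `i` is parallel and
`⟨e₁, i x⟩ = 0`, one finds `ω₂₃ = -(dβ + θ₁)` (`conn_second_third`) and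
`cos β ω₁₂ + sin β ω₁₃ = sin β θ₂` (`conn_first_reeb`). The second fundamental form
`ω₁₃ θ₁ + ω₂₃ θ₂` is symmetric and, by minimality, trace free. Together with the formula for `ω₂₃`
this forces `ω₁₃ = -⋆dβ - θ₂` (`conn_first_third`), where `⋆dβ = β₁ θ₂ - β₂ θ₁`. So its matrix has
diagonal entries `β₂`, `-β₂` and off-diagonal entry `-(1 + β₁)`, and the Gauss equation
`K = 1 + det h` (`localGaussCurvature_eq`) reads `K = 1 - ((1 + β₁)² + β₂²)`.

For the Laplacian, `d ⋆dβ = Δβ θ₁ ∧ θ₂` (`wedge_mul_localLaplacian`). By the above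
`⋆dβ = -θ₂ - ω₁₃`, whose exterior derivative is known from the structure equation
`dθ₂ = θ₁ ∧ ω₁₂` and the Codazzi equation `dω₁₃ = ω₁₂ ∧ ω₂₃`. Where `cos β ≠ 0` the remaining form is
`ω₁₂ = tan β (⋆dβ + 2 θ₂)`, and substituting gives the formula for `Δβ`.

The curvature, gradient and Laplacian are defined through Christoffel symbols in coordinates. The
link with the frame is that the `Γᵏᵢⱼ ∂ₖ x` add up to the tangential part of `∂ᵢ ∂ⱼ x`
(`sum_christoffel_mul_dform`).
-/

noncomputable section

namespace ContactSurface

/-! ### Calculus in the coordinate plane -/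

section Calculus

variable {F : Type*} [NormedAddCommGroup F] [NormedSpace ℝ F] {u : Plane}

theorem contDiffAt_pd {f : Plane → F} (hf : ContDiffAt ℝ ∞ f u) (i : Fin 2) :
    ContDiffAt ℝ ∞ (pd i f) u :=
  (hf.fderiv_right (m := ∞) (by simp)).clm_apply contDiffAt_const

theorem differentiableAt_of_contDiffAt {f : Plane → F} (hf : ContDiffAt ℝ ∞ f u) :
    DifferentiableAt ℝ f u :=
  hf.differentiableAt (by simp)

theorem pd_congr {f g : Plane → F} (h : f =ᶠ[nhds u] g) (i : Fin 2) : pd i f u = pd i g u := by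
  simp only [pd, h.fderiv_eq]

theorem pd_comm {f : Plane → F} (hf : ContDiffAt ℝ ∞ f u) (i j : Fin 2) :
    pd i (pd j f) u = pd j (pd i f) u := by
  have hs : IsSymmSndFDerivAt ℝ f u := hf.isSymmSndFDerivAt (by
    rw [minSmoothness_of_isRCLikeNormedField]; exact WithTop.coe_le_coe.2 (le_top : (2 : ℕ∞) ≤ ⊤))
  have hd : DifferentiableAt ℝ (fderiv ℝ f) u :=
    (hf.fderiv_right (m := ∞) (by simp)).differentiableAt (by simp)
  have key : ∀ k l : Fin 2, pd k (pd l f) u =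
      fderiv ℝ (fderiv ℝ f) u (EuclideanSpace.single k 1) (EuclideanSpace.single l 1) := by
    intro k l
    have : pd l f = fun w => fderiv ℝ f w (EuclideanSpace.single l 1) := rfl
    rw [this, pd, fderiv_clm_apply hd (differentiableAt_const _)]
    simp
  rw [key, key, hs.eq]

theorem pd_inner {f g : Plane → C2} (hf : DifferentiableAt ℝ f u) (hg : DifferentiableAt ℝ g u)
    (i : Fin 2) :
    pd i (fun w => inner ℝ (f w) (g w)) u =
      inner ℝ (pd i f u) (g u) + inner ℝ (f u) (pd i g u) := by
  rw [pd, fderiv_inner_apply ℝ hf hg, add_comm]; rfl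

theorem pd_add {f g : Plane → F} (hf : DifferentiableAt ℝ f u) (hg : DifferentiableAt ℝ g u)
    (i : Fin 2) : pd i (fun w => f w + g w) u = pd i f u + pd i g u := by
  simp only [pd]; rw [fderiv_fun_add hf hg]; rfl

theorem pd_neg (f : Plane → F) (i : Fin 2) : pd i (fun w => -f w) u = -pd i f u := by
  simp only [pd]; rw [fderiv_fun_neg]; rfl

theorem pd_sub {f g : Plane → F} (hf : DifferentiableAt ℝ f u) (hg : DifferentiableAt ℝ g u)
    (i : Fin 2) : pd i (fun w => f w - g w) u = pd i f u - pd i g u := by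
  simp only [pd]; rw [fderiv_fun_sub hf hg]; rfl

theorem pd_smul {a : Plane → ℝ} {f : Plane → F} (ha : DifferentiableAt ℝ a u)
    (hf : DifferentiableAt ℝ f u) (i : Fin 2) :
    pd i (fun w => a w • f w) u = a u • pd i f u + pd i a u • f u := by
  simp only [pd]; rw [fderiv_fun_smul ha hf]; rfl

theorem pd_mul {a b : Plane → ℝ} (ha : DifferentiableAt ℝ a u) (hb : DifferentiableAt ℝ b u)
    (i : Fin 2) : pd i (fun w => a w * b w) u = a u * pd i b u + pd i a u * b u := by
  have := pd_smul ha hb i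
  simpa only [smul_eq_mul] using this

theorem pd_sin {b : Plane → ℝ} (hb : DifferentiableAt ℝ b u) (i : Fin 2) :
    pd i (fun w => Real.sin (b w)) u = Real.cos (b u) * pd i b u := by
  simp only [pd]; rw [fderiv_sin hb]; rfl

theorem pd_cos {b : Plane → ℝ} (hb : DifferentiableAt ℝ b u) (i : Fin 2) :
    pd i (fun w => Real.cos (b w)) u = -(Real.sin (b u) * pd i b u) := by
  simp only [pd]; rw [fderiv_cos hb]; simp

theorem pd_I_smul {f : Plane → C2} (hf : DifferentiableAt ℝ f u) (i : Fin 2) :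
    pd i (fun w => Complex.I • f w) u = Complex.I • pd i f u := by
  simp only [pd]; rw [fderiv_fun_const_smul hf]; rfl

theorem fderiv_apply_eq_pd (f : Plane → F) (v : Plane) :
    fderiv ℝ f u v = v 0 • pd 0 f u + v 1 • pd 1 f u := by
  have hv : v = v 0 • EuclideanSpace.single 0 (1 : ℝ) + v 1 • EuclideanSpace.single 1 (1 : ℝ) := by
    ext i; fin_cases i <;> simp
  conv_lhs => rw [hv]
  simp only [pd, map_add, map_smul]

end Calculus

/-! ### The Euclidean geometry of `ℂ²` -/

theorem inner_I_smul_I_smul (v w : C2) :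
    inner ℝ (Complex.I • v) (Complex.I • w) = inner ℝ v w := by
  simp only [PiLp.inner_apply, Fin.sum_univ_two, PiLp.smul_apply, Complex.inner, smul_eq_mul]
  simp

theorem inner_I_smul_left (v w : C2) :
    inner ℝ (Complex.I • v) w = -inner ℝ v (Complex.I • w) := by
  simp only [PiLp.inner_apply, Fin.sum_univ_two, PiLp.smul_apply, Complex.inner, smul_eq_mul]
  simp; ring

theorem inner_I_smul_self (v : C2) : inner ℝ v (Complex.I • v) = 0 := by
  have := inner_I_smul_left v v
  rw [real_inner_comm] at this; linarith

theorem inner_eq_sum_of_orthonormal {a b c d : C2} (h : Orthonormal ℝ ![a, b, c, d]) (v w : C2) :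
    inner ℝ v w = inner ℝ v a * inner ℝ w a + inner ℝ v b * inner ℝ w b
      + inner ℝ v c * inner ℝ w c + inner ℝ v d * inner ℝ w d := by
  have hr : Module.finrank ℝ C2 = 4 := by
    rw [← Module.finrank_mul_finrank ℝ ℂ C2]; simp
  let B := (basisOfOrthonormalOfCardEqFinrank h (by simp [hr]))
  have hB : ⇑B = ![a, b, c, d] := coe_basisOfOrthonormalOfCardEqFinrank _ _
  let O := B.toOrthonormalBasis (by rw [hB]; exact h)
  have hO : ⇑O = ![a, b, c, d] := by simp [O, hB]
  have := O.sum_inner_mul_inner v w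
  rw [← this, hO, Fin.sum_univ_four]
  simp [real_inner_comm]

/-! ### Adapted frames and their structure equations -/

/-- The one-form `⟨df, e⟩` of two vector-valued functions, by its components `⟨∂ᵢ f, e⟩`. For a
frame `(e₁, e₂, e₃)` along `x`, the forms `dform x eₐ` are the coframe `θₐ` and the forms
`dform eₐ e_b` are the connection forms `ω_ab`. -/
def dform (f e : Plane → C2) (i : Fin 2) (u : Plane) : ℝ := inner ℝ (pd i f u) (e u)

/-- The component `(a ∧ b)(∂₀, ∂₁)` of the wedge product of two one-forms at a point. -/
def wedge (a b : Fin 2 → ℝ) : ℝ := a 0 * b 1 - a 1 * b 0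

/-- Over the open set `U`, `(e₁, e₂, e₃)` is an orthonormal frame of `S³` along the immersed
surface `x` with `e₃` normal to the surface (so that `e₁, e₂` are tangent to it). -/
structure IsAdaptedFrameOn (x e₁ e₂ e₃ : Plane → C2) (U : Set Plane) : Prop where
  isOpen : IsOpen U
  smooth : ∀ u ∈ U, ContDiffAt ℝ ∞ x u
  smooth₁ : ∀ u ∈ U, ContDiffAt ℝ ∞ e₁ u
  smooth₂ : ∀ u ∈ U, ContDiffAt ℝ ∞ e₂ u
  smooth₃ : ∀ u ∈ U, ContDiffAt ℝ ∞ e₃ u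
  orthonormal : ∀ u ∈ U, Orthonormal ℝ ![e₁ u, e₂ u, e₃ u, x u]
  normal : ∀ u ∈ U, ∀ i, dform x e₃ i u = 0
  immersive : ∀ u ∈ U, (metric x u).det ≠ 0

/-- The exterior derivative of `⟨df, e⟩` only involves first derivatives, since the second
derivatives of `f` are symmetric. -/
theorem pd_dform_sub_pd_dform {f e : Plane → C2} {u : Plane} (hf : ContDiffAt ℝ ∞ f u)
    (he : ContDiffAt ℝ ∞ e u) :
    pd 0 (dform f e 1) u - pd 1 (dform f e 0) u =
      inner ℝ (pd 1 f u) (pd 0 e u) - inner ℝ (pd 0 f u) (pd 1 e u) := by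
  have h : ∀ i j, pd i (dform f e j) u =
      inner ℝ (pd i (pd j f) u) (e u) + inner ℝ (pd j f u) (pd i e u) := fun i j =>
    pd_inner (differentiableAt_of_contDiffAt (contDiffAt_pd hf j))
      (differentiableAt_of_contDiffAt he) i
  rw [h, h, pd_comm hf 0 1]
  ring

theorem dform_add_dform_swap {f e : Plane → C2} {u : Plane} {U : Set Plane} (hU : IsOpen U)
    (hu : u ∈ U) (hf : ContDiffAt ℝ ∞ f u) (he : ContDiffAt ℝ ∞ e u) {k : ℝ}
    (h : ∀ w ∈ U, inner ℝ (f w) (e w) = k) (i : Fin 2) : dform f e i u = -dform e f i u := by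
  have h1 := pd_inner (differentiableAt_of_contDiffAt hf) (differentiableAt_of_contDiffAt he) i
  have h2 : pd i (fun w => inner ℝ (f w) (e w)) u = pd i (fun _ => k) u :=
    pd_congr (Filter.eventually_of_mem (hU.mem_nhds hu) h) i
  have h3 : pd i (fun _ : Plane => k) u = 0 := by simp [pd]
  rw [dform, dform, real_inner_comm (f u)]
  linarith

/-- The trace of a bilinear form `P ⊗ θ₁ + Q ⊗ θ₂` for the metric `θ₁² + θ₂²`. -/
theorem sum_inv_mul_eq_of_coframe {g : Matrix (Fin 2) (Fin 2) ℝ} {a b : Fin 2 → ℝ}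
    (hg : ∀ i j, g i j = a i * a j + b i * b j) (hab : wedge a b ≠ 0) (P Q : Fin 2 → ℝ) :
    wedge a b * ∑ i, ∑ j, g⁻¹ i j * (P i * a j + Q i * b j) = wedge P b - wedge Q a := by
  have hdet : g.det = wedge a b ^ 2 := by
    rw [Matrix.det_fin_two]; simp only [hg, wedge]; ring
  rw [Matrix.inv_def, Matrix.adjugate_fin_two, hdet, Ring.inverse_eq_inv']
  simp only [Fin.sum_univ_two, Matrix.smul_apply, smul_eq_mul, Matrix.of_apply, Matrix.cons_val',
    Matrix.cons_val_zero, Matrix.cons_val_one, Matrix.cons_val_fin_one, hg]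
  field_simp
  simp only [wedge]
  ring

namespace IsAdaptedFrameOn

variable {x e₁ e₂ e₃ : Plane → C2} {U : Set Plane} (h : IsAdaptedFrameOn x e₁ e₂ e₃ U)
  {u : Plane} (hu : u ∈ U)

include h hu

theorem inner_eq (v w : C2) :
    inner ℝ v w = inner ℝ v (e₁ u) * inner ℝ w (e₁ u) + inner ℝ v (e₂ u) * inner ℝ w (e₂ u)
      + inner ℝ v (e₃ u) * inner ℝ w (e₃ u) + inner ℝ v (x u) * inner ℝ w (x u) :=
  inner_eq_sum_of_orthonormal (h.orthonormal u hu) v w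

omit hu in
theorem inner_frame (k l : Fin 4) : ∀ w ∈ U,
    inner ℝ ((![e₁, e₂, e₃, x] : Fin 4 → Plane → C2) k w)
      ((![e₁, e₂, e₃, x] : Fin 4 → Plane → C2) l w) = if k = l then (1 : ℝ) else 0 := by
  intro w hw
  have := orthonormal_iff_ite.1 (h.orthonormal w hw) k l
  rw [← this]
  fin_cases k <;> fin_cases l <;> rfl

omit hu in
theorem smooth_frame (k : Fin 4) : ∀ w ∈ U,
    ContDiffAt ℝ ∞ ((![e₁, e₂, e₃, x] : Fin 4 → Plane → C2) k) w := by
  intro w hw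
  fin_cases k
  exacts [h.smooth₁ w hw, h.smooth₂ w hw, h.smooth₃ w hw, h.smooth w hw]

theorem dform_frame_swap (k l : Fin 4) (i : Fin 2) :
    dform ((![e₁, e₂, e₃, x] : Fin 4 → Plane → C2) k)
        ((![e₁, e₂, e₃, x] : Fin 4 → Plane → C2) l) i u =
      -dform ((![e₁, e₂, e₃, x] : Fin 4 → Plane → C2) l)
        ((![e₁, e₂, e₃, x] : Fin 4 → Plane → C2) k) i u :=
  dform_add_dform_swap h.isOpen hu (h.smooth_frame k u hu) (h.smooth_frame l u hu)
    (h.inner_frame k l) i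

theorem dform_frame_self (k : Fin 4) (i : Fin 2) :
    dform ((![e₁, e₂, e₃, x] : Fin 4 → Plane → C2) k)
      ((![e₁, e₂, e₃, x] : Fin 4 → Plane → C2) k) i u = 0 := by
  have := h.dform_frame_swap hu k k i
  linarith

theorem dform_position_self (i : Fin 2) : dform x x i u = 0 :=
  h.dform_frame_self hu 3 i

/-- The coframe diagonalizes the metric: `g = θ₁² + θ₂²`. -/
theorem metric_eq (i j : Fin 2) :
    metric x u i j = dform x e₁ i u * dform x e₁ j u + dform x e₂ i u * dform x e₂ j u := by
  have hn := h.normal u hu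
  have hx := h.dform_position_self hu
  simp only [dform] at hn hx
  rw [metric, Matrix.of_apply, h.inner_eq hu, hn, hx]
  simp [dform]

theorem det_metric : (metric x u).det = wedge (dform x e₁ · u) (dform x e₂ · u) ^ 2 := by
  rw [Matrix.det_fin_two]
  simp only [h.metric_eq hu, wedge]
  ring

theorem wedge_coframe_ne_zero : wedge (dform x e₁ · u) (dform x e₂ · u) ≠ 0 := by
  intro h0
  apply h.immersive u hu
  rw [h.det_metric hu, h0]
  simp

theorem contDiffAt_metric (i j : Fin 2) : ContDiffAt ℝ ∞ (fun w => metric x w i j) u :=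
  (contDiffAt_pd (h.smooth u hu) i).inner ℝ (contDiffAt_pd (h.smooth u hu) j)

theorem contDiffAt_inv_metric (i j : Fin 2) : ContDiffAt ℝ ∞ (fun w => (metric x w)⁻¹ i j) u := by
  have hm := h.contDiffAt_metric hu
  have hdet : ContDiffAt ℝ ∞ (fun w => ((metric x w).det)⁻¹) u := by
    refine ContDiffAt.inv ?_ (h.immersive u hu)
    simp only [Matrix.det_fin_two]
    exact ((hm 0 0).mul (hm 1 1)).sub ((hm 0 1).mul (hm 1 0))
  simp only [Matrix.inv_def, Matrix.adjugate_fin_two, Ring.inverse_eq_inv', Matrix.smul_apply,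
    smul_eq_mul]
  refine hdet.mul ?_
  fin_cases i <;> fin_cases j
  exacts [hm 1 1, (hm 0 1).neg, (hm 1 0).neg, hm 0 0]

/-- The Christoffel symbols give the tangential part of the second derivatives of `x`. -/
theorem christoffel_eq (k i j : Fin 2) :
    christoffel x k i j u =
      ∑ l, (metric x u)⁻¹ k l * inner ℝ (pd i (pd j x) u) (pd l x u) := by
  have hd : ∀ l, DifferentiableAt ℝ (pd l x) u := fun l =>
    differentiableAt_of_contDiffAt (contDiffAt_pd (h.smooth u hu) l)
  have hp : ∀ i j l, pd i (fun w => metric x w j l) u =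
      inner ℝ (pd i (pd j x) u) (pd l x u) + inner ℝ (pd j x u) (pd i (pd l x) u) :=
    fun i j l => pd_inner (hd j) (hd l) i
  rw [christoffel, Finset.mul_sum]
  refine Finset.sum_congr rfl fun l _ => ?_
  rw [hp, hp, hp, pd_comm (h.smooth u hu) j i, pd_comm (h.smooth u hu) l i,
    pd_comm (h.smooth u hu) l j, real_inner_comm (pd j x u)]
  ring

theorem contDiffAt_christoffel (k i j : Fin 2) : ContDiffAt ℝ ∞ (christoffel x k i j) u := by
  have : (fun w => ∑ l, (metric x w)⁻¹ k l * inner ℝ (pd i (pd j x) w) (pd l x w))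
      =ᶠ[nhds u] christoffel x k i j :=
    Filter.eventually_of_mem (h.isOpen.mem_nhds hu) fun w hw => (h.christoffel_eq hw k i j).symm
  refine ContDiffAt.congr_of_eventuallyEq ?_ this.symm
  refine ContDiffAt.sum fun l _ => (h.contDiffAt_inv_metric hu k l).mul ?_
  exact (contDiffAt_pd (contDiffAt_pd (h.smooth u hu) j) i).inner ℝ
    (contDiffAt_pd (h.smooth u hu) l)

theorem sum_christoffel_mul_metric (i j n : Fin 2) :
    ∑ k, christoffel x k i j u * metric x u k n = inner ℝ (pd i (pd j x) u) (pd n x u) := by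
  have hs : ∀ k l, metric x u k l = metric x u l k := fun k l =>
    real_inner_comm (pd l x u) (pd k x u)
  have hi' : ∀ l, ∑ k, (metric x u)⁻¹ k l * metric x u k n = if l = n then (1 : ℝ) else 0 := by
    intro l
    have ht : metric x u * (metric x u)⁻¹ = 1 :=
      Matrix.mul_nonsing_inv _ (isUnit_iff_ne_zero.2 (h.immersive u hu))
    have := congrFun (congrFun ht n) l
    rw [Matrix.mul_apply, Matrix.one_apply] at this
    simp only [eq_comm (a := l)]
    rw [← this]
    exact Finset.sum_congr rfl fun k _ => by rw [hs k n, mul_comm]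
  simp only [h.christoffel_eq hu, Finset.sum_mul]
  rw [Finset.sum_comm]
  simp only [mul_right_comm _ (inner ℝ _ _)]
  simp only [← Finset.sum_mul, hi']
  simp

/-- A vector orthogonal to both coordinate fields is orthogonal to `e₁` and `e₂`. -/
theorem inner_frame_eq_zero {z : C2} (hz : ∀ n, inner ℝ z (pd n x u) = 0) :
    inner ℝ z (e₁ u) = 0 ∧ inner ℝ z (e₂ u) = 0 := by
  have hJ := h.wedge_coframe_ne_zero hu
  have hn := h.normal u hu
  have hx := h.dform_position_self hu
  have key : ∀ n, inner ℝ z (e₁ u) * dform x e₁ n u + inner ℝ z (e₂ u) * dform x e₂ n u = 0 := by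
    intro n
    have := hz n
    rw [h.inner_eq hu] at this
    simp only [dform] at hn hx ⊢
    rw [hn, hx] at this
    linarith
  have k0 := key 0
  have k1 := key 1
  constructor
  · refine (mul_eq_zero.1 (?_ : _ * wedge (dform x e₁ · u) (dform x e₂ · u) = 0)).resolve_right hJ
    simp only [wedge]
    linear_combination dform x e₂ 1 u * k0 - dform x e₂ 0 u * k1
  · refine (mul_eq_zero.1 (?_ : _ * wedge (dform x e₁ · u) (dform x e₂ · u) = 0)).resolve_right hJ
    simp only [wedge]
    linear_combination dform x e₁ 0 u * k1 - dform x e₁ 1 u * k0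

theorem sum_christoffel_mul_dform (i j : Fin 2) :
    ∑ k, christoffel x k i j u * dform x e₁ k u = inner ℝ (pd i (pd j x) u) (e₁ u) ∧
    ∑ k, christoffel x k i j u * dform x e₂ k u = inner ℝ (pd i (pd j x) u) (e₂ u) := by
  have := h.inner_frame_eq_zero hu
    (z := pd i (pd j x) u - ∑ k, christoffel x k i j u • pd k x u) (by
      intro n
      rw [inner_sub_left, sum_inner, ← h.sum_christoffel_mul_metric hu, sub_eq_zero]
      exact Finset.sum_congr rfl fun k _ => by rw [real_inner_smul_left]; rfl)
  simp only [inner_sub_left, sum_inner, real_inner_smul_left, sub_eq_zero] at this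
  exact ⟨this.1.symm, this.2.symm⟩

/-- The second fundamental form `h_ij = ⟨∂ᵢ ∂ⱼ x, e₃⟩` in terms of connection forms. -/
theorem inner_second_derivative_normal (i j : Fin 2) :
    inner ℝ (pd i (pd j x) u) (e₃ u) =
      dform e₁ e₃ i u * dform x e₁ j u + dform e₂ e₃ i u * dform x e₂ j u := by
  have h1 := pd_inner (differentiableAt_of_contDiffAt (contDiffAt_pd (h.smooth u hu) j))
    (differentiableAt_of_contDiffAt (h.smooth₃ u hu)) i
  have h2 : pd i (fun w => inner ℝ (pd j x w) (e₃ w)) u = pd i (fun _ => (0 : ℝ)) u :=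
    pd_congr (Filter.eventually_of_mem (h.isOpen.mem_nhds hu) fun w hw => h.normal w hw j) i
  have h3 : pd i (fun _ : Plane => (0 : ℝ)) u = 0 := by simp [pd]
  have s1 : dform e₁ e₃ i u = -dform e₃ e₁ i u := h.dform_frame_swap hu 0 2 i
  have s2 : dform e₂ e₃ i u = -dform e₃ e₂ i u := h.dform_frame_swap hu 1 2 i
  have hn := h.normal u hu j
  have hx := h.dform_position_self hu j
  rw [h.inner_eq hu (pd j x u)] at h1
  simp only [dform] at hn hx s1 s2 ⊢
  rw [hn, hx] at h1
  rw [s1, s2]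
  linarith

theorem inner_second_derivative_position (i j : Fin 2) :
    inner ℝ (pd i (pd j x) u) (x u) = -metric x u i j := by
  have h1 := pd_inner (differentiableAt_of_contDiffAt (contDiffAt_pd (h.smooth u hu) j))
    (differentiableAt_of_contDiffAt (h.smooth u hu)) i
  have h2 : pd i (fun w => inner ℝ (pd j x w) (x w)) u = pd i (fun _ => (0 : ℝ)) u :=
    pd_congr (Filter.eventually_of_mem (h.isOpen.mem_nhds hu)
      fun w hw => h.dform_position_self hw j) i
  have h3 : pd i (fun _ : Plane => (0 : ℝ)) u = 0 := by simp [pd]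
  rw [metric, Matrix.of_apply, real_inner_comm (pd j x u)]
  linarith

/-- The equality of mixed partial derivatives of `x` makes the second fundamental form
symmetric. -/
theorem wedge_second_form :
    wedge (dform e₁ e₃ · u) (dform x e₁ · u) + wedge (dform e₂ e₃ · u) (dform x e₂ · u) = 0 := by
  have h1 := h.inner_second_derivative_normal hu 0 1
  have h2 := h.inner_second_derivative_normal hu 1 0
  rw [pd_comm (h.smooth u hu)] at h1
  simp only [wedge]
  linarith

theorem wedge_mul_localMeanCurvature :
    wedge (dform x e₁ · u) (dform x e₂ · u) * localMeanCurvature x (e₃ u) u =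
      (1 / 2) * (wedge (dform e₁ e₃ · u) (dform x e₂ · u)
        - wedge (dform e₂ e₃ · u) (dform x e₁ · u)) := by
  rw [← sum_inv_mul_eq_of_coframe (h.metric_eq hu) (h.wedge_coframe_ne_zero hu),
    localMeanCurvature]
  simp only [h.inner_second_derivative_normal hu]
  ring

end IsAdaptedFrameOn

/-! ### The Gauss equation and the Laplacian in an adapted frame -/

namespace IsAdaptedFrameOn

variable {x e₁ e₂ e₃ : Plane → C2} {U : Set Plane} (h : IsAdaptedFrameOn x e₁ e₂ e₃ U)
  {u : Plane} (hu : u ∈ U)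

include h hu

theorem sum_christoffel_mul_inner (i j : Fin 2) (v : C2) :
    ∑ k, christoffel x k i j u * inner ℝ (pd k x u) v =
      inner ℝ (pd i (pd j x) u) v - inner ℝ (pd i (pd j x) u) (e₃ u) * inner ℝ v (e₃ u)
        + metric x u i j * inner ℝ v (x u) := by
  have hn := h.normal u hu
  have hx := h.dform_position_self hu
  obtain ⟨c1, c2⟩ := h.sum_christoffel_mul_dform hu i j
  rw [h.inner_eq hu (pd i (pd j x) u) v, ← c1, ← c2, h.inner_second_derivative_position hu]
  simp only [dform] at hn hx ⊢
  simp only [Fin.sum_univ_two, h.inner_eq hu (pd _ x u) v, hn, hx]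
  ring

/-- One of the two halves of the curvature tensor: the derivative of
`∑ₖ Γᵏᵢⱼ ⟨∂ₖ x, ∂ₙ x⟩ = ⟨∂ᵢ ∂ⱼ x, ∂ₙ x⟩`. Apart from a third derivative of `x`, which cancels in the
curvature tensor, only the normal part of the second derivatives is left. -/
theorem sum_pd_christoffel_mul_metric (i j k n : Fin 2) :
    ∑ l, (pd i (christoffel x l j k) u
        + ∑ m, christoffel x l i m u * christoffel x m j k u) * metric x u l n =
      inner ℝ (pd i (pd j (pd k x)) u) (pd n x u)
        + inner ℝ (pd j (pd k x) u) (e₃ u) * inner ℝ (pd i (pd n x) u) (e₃ u)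
        + metric x u j k * metric x u i n := by
  have hX : ∀ l, ContDiffAt ℝ ∞ (pd l x) u := fun l => contDiffAt_pd (h.smooth u hu) l
  have d : ∀ l, DifferentiableAt ℝ (fun w => christoffel x l j k w * metric x w l n) u := fun l =>
    (differentiableAt_of_contDiffAt (h.contDiffAt_christoffel hu l j k)).mul
      (differentiableAt_of_contDiffAt (h.contDiffAt_metric hu l n))
  have e : ∀ l, pd i (fun w => christoffel x l j k w * metric x w l n) u =
      christoffel x l j k u * (inner ℝ (pd i (pd l x) u) (pd n x u)
        + inner ℝ (pd l x u) (pd i (pd n x) u))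
        + pd i (christoffel x l j k) u * metric x u l n := fun l => by
    rw [pd_mul (differentiableAt_of_contDiffAt (h.contDiffAt_christoffel hu l j k))
      (differentiableAt_of_contDiffAt (h.contDiffAt_metric hu l n))]
    congr 2
    exact pd_inner (differentiableAt_of_contDiffAt (hX l)) (differentiableAt_of_contDiffAt (hX n)) i
  have h1 : pd i (fun w => ∑ l, christoffel x l j k w * metric x w l n) u =
      pd i (fun w => inner ℝ (pd j (pd k x) w) (pd n x w)) u :=
    pd_congr (Filter.eventually_of_mem (h.isOpen.mem_nhds hu)
      fun w hw => h.sum_christoffel_mul_metric hw j k n) i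
  simp only [Fin.sum_univ_two] at h1
  rw [pd_add (d 0) (d 1), e, e,
    pd_inner (differentiableAt_of_contDiffAt (contDiffAt_pd (hX k) j))
      (differentiableAt_of_contDiffAt (hX n))] at h1
  have h2 := h.sum_christoffel_mul_inner hu j k (pd i (pd n x) u)
  rw [h.inner_second_derivative_position hu i n] at h2
  have h3 := fun m => h.sum_christoffel_mul_metric hu i m n
  have h30 := h3 0
  have h31 := h3 1
  simp only [Fin.sum_univ_two] at h2 h30 h31 ⊢
  linear_combination h1 - h2 + christoffel x 0 j k u * h30 + christoffel x 1 j k u * h31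

/-- The Gauss equation in `S³`: `K = 1 + det h / det g`, where `det h / det g` is the quotient
of `ω₁₃ ∧ ω₂₃` by the area form. -/
theorem localGaussCurvature_eq :
    localGaussCurvature x u = 1 + wedge (dform e₁ e₃ · u) (dform e₂ e₃ · u)
      / wedge (dform x e₁ · u) (dform x e₂ · u) := by
  have hJ := h.wedge_coframe_ne_zero hu
  have h1 := h.sum_pd_christoffel_mul_metric hu 0 1 1 0
  have h2 := h.sum_pd_christoffel_mul_metric hu 1 0 1 0
  -- The third derivatives in the two halves agree.
  have h3 : pd 0 (pd 1 (pd 1 x)) u = pd 1 (pd 0 (pd 1 x)) u :=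
    pd_comm (contDiffAt_pd (h.smooth u hu) 1) 0 1
  have hR : ∑ l, riemann x l 0 1 1 u * metric x u l 0 =
      (metric x u).det + wedge (dform e₁ e₃ · u) (dform e₂ e₃ · u)
        * wedge (dform x e₁ · u) (dform x e₂ · u) := by
    have hm : metric x u 1 0 = metric x u 0 1 := real_inner_comm (pd 0 x u) (pd 1 x u)
    simp only [h.inner_second_derivative_normal hu] at h1 h2
    rw [Matrix.det_fin_two]
    simp only [riemann, Fin.sum_univ_two, wedge] at h1 h2 ⊢
    rw [h3] at h1
    linear_combination h1 - h2
  rw [localGaussCurvature, hR, h.det_metric hu]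
  field_simp

theorem inner_localGrad (b : Plane → ℝ) (n : Fin 2) :
    inner ℝ (localGrad x b u) (pd n x u) = pd n b u := by
  have ht : metric x u * (metric x u)⁻¹ = 1 :=
    Matrix.mul_nonsing_inv _ (isUnit_iff_ne_zero.2 (h.immersive u hu))
  have key : ∀ j, ∑ i, metric x u n i * (metric x u)⁻¹ i j = if n = j then (1 : ℝ) else 0 := by
    intro j
    rw [← Matrix.mul_apply, ht, Matrix.one_apply]
  simp only [localGrad, sum_inner, real_inner_smul_left]
  have : ∀ i j, (metric x u)⁻¹ i j * pd j b u * inner ℝ (pd i x u) (pd n x u) =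
      metric x u n i * (metric x u)⁻¹ i j * pd j b u := by
    intro i j
    rw [metric, Matrix.of_apply, real_inner_comm]
    ring
  simp only [this]
  rw [Finset.sum_comm]
  simp only [← Finset.sum_mul, key]
  simp

theorem inner_localGrad_fderiv (b : Plane → ℝ) (v : Plane) :
    inner ℝ (localGrad x b u) (fderiv ℝ x u v) = fderiv ℝ b u v := by
  simp only [fderiv_apply_eq_pd, inner_add_right, real_inner_smul_right, h.inner_localGrad hu,
    smul_eq_mul]

theorem inner_localGrad_normal (b : Plane → ℝ) :
    inner ℝ (localGrad x b u) (e₃ u) = 0 ∧ inner ℝ (localGrad x b u) (x u) = 0 := by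
  have hn := h.normal u hu
  have hx := h.dform_position_self hu
  simp only [dform] at hn hx
  simp only [localGrad, sum_inner, real_inner_smul_left, hn, hx]
  simp

/-- The differential in the coframe: `db = ⟨∇b, e₁⟩ θ₁ + ⟨∇b, e₂⟩ θ₂`. -/
theorem pd_eq_coframe (b : Plane → ℝ) (i : Fin 2) :
    pd i b u = inner ℝ (localGrad x b u) (e₁ u) * dform x e₁ i u
      + inner ℝ (localGrad x b u) (e₂ u) * dform x e₂ i u := by
  rw [← h.inner_localGrad hu, h.inner_eq hu, (h.inner_localGrad_normal hu b).1,
    (h.inner_localGrad_normal hu b).2]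
  simp [dform]

theorem contDiffAt_localGrad {b : Plane → ℝ} (hb : ContDiffAt ℝ ∞ b u) :
    ContDiffAt ℝ ∞ (localGrad x b) u :=
  ContDiffAt.sum fun i _ => ContDiffAt.sum fun j _ =>
    ((h.contDiffAt_inv_metric hu i j).mul (contDiffAt_pd hb j)).smul
      (contDiffAt_pd (h.smooth u hu) i)

/-- The Laplacian as the exterior derivative of the Hodge dual
`⋆db = ⟨∇b, e₁⟩ θ₂ - ⟨∇b, e₂⟩ θ₁` of the differential. -/
theorem wedge_mul_localLaplacian {b : Plane → ℝ} (hb : ContDiffAt ℝ ∞ b u)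
    {s : Fin 2 → Plane → ℝ}
    (hs : ∀ i, ∀ w ∈ U, s i w = inner ℝ (localGrad x b w) (e₁ w) * dform x e₂ i w
      - inner ℝ (localGrad x b w) (e₂ w) * dform x e₁ i w) :
    wedge (dform x e₁ · u) (dform x e₂ · u) * localLaplacian x b u =
      pd 0 (s 1) u - pd 1 (s 0) u := by
  set b₁ : Plane → ℝ := fun w => inner ℝ (localGrad x b w) (e₁ w) with hb₁
  set b₂ : Plane → ℝ := fun w => inner ℝ (localGrad x b w) (e₂ w) with hb₂
  have hG := h.contDiffAt_localGrad hu hb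
  have d1 : DifferentiableAt ℝ b₁ u :=
    differentiableAt_of_contDiffAt (hG.inner ℝ (h.smooth₁ u hu))
  have d2 : DifferentiableAt ℝ b₂ u :=
    differentiableAt_of_contDiffAt (hG.inner ℝ (h.smooth₂ u hu))
  have dθ : ∀ e : Plane → C2, ContDiffAt ℝ ∞ e u → ∀ j, DifferentiableAt ℝ (dform x e j) u :=
    fun e he j => differentiableAt_of_contDiffAt ((contDiffAt_pd (h.smooth u hu) j).inner ℝ he)
  have pθ : ∀ e : Plane → C2, ContDiffAt ℝ ∞ e u → ∀ i j, pd i (dform x e j) u =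
      inner ℝ (pd i (pd j x) u) (e u) + inner ℝ (pd j x u) (pd i e u) := fun e he i j =>
    pd_inner (differentiableAt_of_contDiffAt (contDiffAt_pd (h.smooth u hu) j))
      (differentiableAt_of_contDiffAt he) i
  -- The connection forms enter through the derivatives of the tangent frame.
  have hn := h.normal u hu
  have hx := h.dform_position_self hu
  have conn11 : ∀ i, dform e₁ e₁ i u = 0 := h.dform_frame_self hu 0
  have conn22 : ∀ i, dform e₂ e₂ i u = 0 := h.dform_frame_self hu 1
  have conn21 : ∀ i, dform e₂ e₁ i u = -dform e₁ e₂ i u := fun i => h.dform_frame_swap hu 1 0 i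
  have p1 : ∀ i j, pd i (dform x e₁ j) u =
      inner ℝ (pd i (pd j x) u) (e₁ u) + dform x e₂ j u * dform e₁ e₂ i u := fun i j => by
    have conn := conn11 i
    rw [pθ e₁ (h.smooth₁ u hu), h.inner_eq hu (pd j x u)]
    simp only [dform] at hn hx conn ⊢
    rw [hn, hx, conn]
    ring
  have p2 : ∀ i j, pd i (dform x e₂ j) u =
      inner ℝ (pd i (pd j x) u) (e₂ u) - dform x e₁ j u * dform e₁ e₂ i u := fun i j => by
    have conn := conn22 i
    have conn' := conn21 i
    rw [pθ e₂ (h.smooth₂ u hu), h.inner_eq hu (pd j x u)]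
    simp only [dform] at hn hx conn conn' ⊢
    rw [hn, hx, conn, conn']
    ring
  have hess : ∀ i j, pd i (pd j b) u - ∑ k, christoffel x k i j u * pd k b u =
      (pd i b₁ u - b₂ u * dform e₁ e₂ i u) * dform x e₁ j u
        + (pd i b₂ u + b₁ u * dform e₁ e₂ i u) * dform x e₂ j u := by
    intro i j
    have hb' : pd i (pd j b) u =
        pd i (fun w => b₁ w * dform x e₁ j w + b₂ w * dform x e₂ j w) u :=
      pd_congr (Filter.eventually_of_mem (h.isOpen.mem_nhds hu)
        fun w hw => h.pd_eq_coframe hw b j) i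
    obtain ⟨c1, c2⟩ := h.sum_christoffel_mul_dform hu i j
    rw [hb', pd_add (d1.fun_mul (dθ e₁ (h.smooth₁ u hu) j)) (d2.fun_mul (dθ e₂ (h.smooth₂ u hu) j)),
      pd_mul d1 (dθ e₁ (h.smooth₁ u hu) j), pd_mul d2 (dθ e₂ (h.smooth₂ u hu) j), p1, p2,
      ← c1, ← c2]
    simp only [h.pd_eq_coframe hu b, Fin.sum_univ_two, hb₁, hb₂]
    ring
  have star : ∀ i j, pd i (s j) u =
      pd i b₁ u * dform x e₂ j u - pd i b₂ u * dform x e₁ j u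
        + b₁ u * pd i (dform x e₂ j) u - b₂ u * pd i (dform x e₁ j) u := by
    intro i j
    have hs' : pd i (s j) u = pd i (fun w => b₁ w * dform x e₂ j w - b₂ w * dform x e₁ j w) u :=
      pd_congr (Filter.eventually_of_mem (h.isOpen.mem_nhds hu) fun w hw => hs j w hw) i
    rw [hs', pd_sub (d1.fun_mul (dθ e₂ (h.smooth₂ u hu) j)) (d2.fun_mul (dθ e₁ (h.smooth₁ u hu) j)),
      pd_mul d1 (dθ e₂ (h.smooth₂ u hu) j), pd_mul d2 (dθ e₁ (h.smooth₁ u hu) j)]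
    ring
  simp only [localLaplacian, hess]
  rw [sum_inv_mul_eq_of_coframe (h.metric_eq hu) (h.wedge_coframe_ne_zero hu)
    (fun i => pd i b₁ u - b₂ u * dform e₁ e₂ i u) (fun i => pd i b₂ u + b₁ u * dform e₁ e₂ i u),
    star, star, p1, p1, p2, p2, pd_comm (h.smooth u hu) 1 0]
  simp only [wedge]
  ring

/-- The first structure equation `dθ₂ = θ₁ ∧ ω₁₂`. -/
theorem pd_coframe_sub :
    pd 0 (dform x e₂ 1) u - pd 1 (dform x e₂ 0) u =
      wedge (dform x e₁ · u) (dform e₁ e₂ · u) := by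
  have hn := h.normal u hu
  have hx := h.dform_position_self hu
  have conn22 : ∀ i, dform e₂ e₂ i u = 0 := h.dform_frame_self hu 1
  have conn21 : ∀ i, dform e₂ e₁ i u = -dform e₁ e₂ i u := fun i => h.dform_frame_swap hu 1 0 i
  rw [pd_dform_sub_pd_dform (h.smooth u hu) (h.smooth₂ u hu), h.inner_eq hu (pd 1 x u),
    h.inner_eq hu (pd 0 x u)]
  simp only [wedge]
  simp only [dform] at hn hx conn22 conn21 ⊢
  rw [hn, hn, hx, hx, conn22, conn22, conn21, conn21]
  ring

/-- The Codazzi equation `dω₁₃ = ω₁₂ ∧ ω₂₃`. -/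
theorem pd_connection_sub :
    pd 0 (dform e₁ e₃ 1) u - pd 1 (dform e₁ e₃ 0) u =
      wedge (dform e₁ e₂ · u) (dform e₂ e₃ · u) := by
  have conn11 : ∀ i, dform e₁ e₁ i u = 0 := h.dform_frame_self hu 0
  have conn33 : ∀ i, dform e₃ e₃ i u = 0 := h.dform_frame_self hu 2
  have conn32 : ∀ i, dform e₃ e₂ i u = -dform e₂ e₃ i u := fun i => h.dform_frame_swap hu 2 1 i
  have conn3x : ∀ i, dform e₃ x i u = 0 := fun i => by
    have : dform e₃ x i u = -dform x e₃ i u := h.dform_frame_swap hu 2 3 i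
    rw [this, h.normal u hu, neg_zero]
  rw [pd_dform_sub_pd_dform (h.smooth₁ u hu) (h.smooth₃ u hu), h.inner_eq hu (pd 1 e₁ u),
    h.inner_eq hu (pd 0 e₁ u)]
  simp only [wedge]
  simp only [dform] at conn11 conn33 conn32 conn3x ⊢
  rw [conn11, conn11, conn33, conn33, conn32, conn32, conn3x, conn3x]
  ring

end IsAdaptedFrameOn

/-! ### Minimal surfaces and the contact angle -/

/-- An adapted frame over `U` of a minimal surface whose vectors `e₂`, `e₃` are obtained from
`(i e₁, ξ)` through the contact angle `b`. -/
structure IsMinimalContactFrameOn (x e₁ e₂ e₃ : Plane → C2) (b : Plane → ℝ) (U : Set Plane) : Prop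
    extends IsAdaptedFrameOn x e₁ e₂ e₃ U where
  smooth_angle : ∀ u ∈ U, ContDiffAt ℝ ∞ b u
  second_eq : ∀ u ∈ U,
    e₂ u = Real.sin (b u) • (Complex.I • e₁ u) + Real.cos (b u) • (Complex.I • x u)
  third_eq : ∀ u ∈ U,
    e₃ u = -Real.cos (b u) • (Complex.I • e₁ u) + Real.sin (b u) • (Complex.I • x u)
  minimal : ∀ u ∈ U, localMeanCurvature x (e₃ u) u = 0

namespace IsMinimalContactFrameOn

variable {x e₁ e₂ e₃ : Plane → C2} {b : Plane → ℝ} {U : Set Plane}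
  (h : IsMinimalContactFrameOn x e₁ e₂ e₃ b U) {u : Plane} (hu : u ∈ U)

include h hu

theorem I_smul_first :
    Complex.I • e₁ u = Real.sin (b u) • e₂ u - Real.cos (b u) • e₃ u := by
  rw [h.second_eq u hu, h.third_eq u hu]
  have : Real.sin (b u) • (Real.sin (b u) • (Complex.I • e₁ u) + Real.cos (b u) • (Complex.I • x u))
      - Real.cos (b u) • (-Real.cos (b u) • (Complex.I • e₁ u)
        + Real.sin (b u) • (Complex.I • x u)) =
      (Real.sin (b u) ^ 2 + Real.cos (b u) ^ 2) • (Complex.I • e₁ u) := by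
    module
  rw [this, Real.sin_sq_add_cos_sq, one_smul]

/-- `ω₂₃ = -(db + θ₁)`: rotating the frame `(i e₁, ξ)` by the angle `b` contributes `-db`, and
the derivative of the Reeb field contributes `-θ₁`. -/
theorem conn_second_third (i : Fin 2) :
    dform e₂ e₃ i u = -(pd i b u + dform x e₁ i u) := by
  have hA := h.toIsAdaptedFrameOn
  have db := differentiableAt_of_contDiffAt (h.smooth_angle u hu)
  have dx := differentiableAt_of_contDiffAt (h.smooth u hu)
  have d1 := differentiableAt_of_contDiffAt (h.smooth₁ u hu)
  have e : pd i e₂ u = pd i (fun w => Real.sin (b w) • (Complex.I • e₁ w)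
      + Real.cos (b w) • (Complex.I • x w)) u :=
    pd_congr (Filter.eventually_of_mem (h.isOpen.mem_nhds hu) h.second_eq) i
  rw [pd_add (db.sin.fun_smul (d1.fun_const_smul Complex.I))
      (db.cos.fun_smul (dx.fun_const_smul Complex.I)),
    pd_smul db.sin (d1.fun_const_smul Complex.I), pd_smul db.cos (dx.fun_const_smul Complex.I),
    pd_sin db, pd_cos db, pd_I_smul d1, pd_I_smul dx] at e
  have a1 : inner ℝ (pd i e₁ u) (e₁ u) = 0 := hA.dform_frame_self hu 0 i
  have a2 : inner ℝ (pd i e₁ u) (x u) = -inner ℝ (pd i x u) (e₁ u) := hA.dform_frame_swap hu 0 3 i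
  have a3 : inner ℝ (pd i x u) (x u) = 0 := hA.dform_position_self hu i
  have a4 : inner ℝ (e₁ u) (e₁ u) = 1 := by simpa using hA.inner_frame 0 0 u hu
  have a5 : inner ℝ (e₁ u) (x u) = 0 := by simpa using hA.inner_frame 0 3 u hu
  have a6 : inner ℝ (x u) (x u) = 1 := by simpa using hA.inner_frame 3 3 u hu
  have a7 : inner ℝ (x u) (e₁ u) = 0 := by rw [real_inner_comm, a5]
  simp only [dform]
  rw [e, h.third_eq u hu]
  simp only [inner_add_left, inner_add_right, real_inner_smul_left, real_inner_smul_right,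
    inner_I_smul_I_smul, a1, a2, a3, a4, a5, a6, a7]
  linear_combination (-(pd i b u) - inner ℝ (pd i x u) (e₁ u)) * Real.sin_sq_add_cos_sq (b u)

/-- The form `⟨de₁, ξ⟩ = cos b ω₁₂ + sin b ω₁₃` equals `sin b θ₂`: differentiating
`⟨e₁, i x⟩ = 0` gives `⟨de₁, i x⟩ = ⟨i e₁, dx⟩`, and `sin b e₂` is the tangential part of `i e₁`. -/
theorem conn_first_reeb (i : Fin 2) :
    Real.cos (b u) * dform e₁ e₂ i u + Real.sin (b u) * dform e₁ e₃ i u =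
      Real.sin (b u) * dform x e₂ i u := by
  have hA := h.toIsAdaptedFrameOn
  have dx := differentiableAt_of_contDiffAt (h.smooth u hu)
  have d1 := differentiableAt_of_contDiffAt (h.smooth₁ u hu)
  have hn := h.normal u hu i
  have hξ : ∀ w ∈ U, Complex.I • x w = Real.cos (b w) • e₂ w + Real.sin (b w) • e₃ w := by
    intro w hw
    rw [h.second_eq w hw, h.third_eq w hw]
    have : Real.cos (b w) • (Real.sin (b w) • (Complex.I • e₁ w)
          + Real.cos (b w) • (Complex.I • x w))
        + Real.sin (b w) • (-Real.cos (b w) • (Complex.I • e₁ w)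
          + Real.sin (b w) • (Complex.I • x w)) =
        (Real.sin (b w) ^ 2 + Real.cos (b w) ^ 2) • (Complex.I • x w) := by
      module
    rw [this, Real.sin_sq_add_cos_sq, one_smul]
  have h0 : ∀ w ∈ U, inner ℝ (e₁ w) (Complex.I • x w) = 0 := by
    intro w hw
    have a2 : inner ℝ (e₁ w) (e₂ w) = 0 := by simpa using hA.inner_frame 0 1 w hw
    have a3 : inner ℝ (e₁ w) (e₃ w) = 0 := by simpa using hA.inner_frame 0 2 w hw
    rw [hξ w hw, inner_add_right, real_inner_smul_right, real_inner_smul_right, a2, a3]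
    ring
  have h1 : pd i (fun w => inner ℝ (e₁ w) (Complex.I • x w)) u = pd i (fun _ => (0 : ℝ)) u :=
    pd_congr (Filter.eventually_of_mem (h.isOpen.mem_nhds hu) h0) i
  have h2 : pd i (fun _ : Plane => (0 : ℝ)) u = 0 := by simp [pd]
  rw [pd_inner d1 (dx.fun_const_smul Complex.I), pd_I_smul dx, h2, hξ u hu,
    ← neg_neg (inner ℝ (e₁ u) _), ← inner_I_smul_left, h.I_smul_first hu] at h1
  simp only [inner_add_right, inner_sub_left, real_inner_smul_right, real_inner_smul_left] at h1
  simp only [dform] at hn ⊢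
  rw [real_inner_comm (pd i x u) (e₂ u), real_inner_comm (pd i x u) (e₃ u), hn] at h1
  linarith

/-- Symmetry of the second fundamental form and minimality turn the formula for `ω₂₃` into
`ω₁₃ = -⋆db - θ₂`. -/
theorem conn_first_third (i : Fin 2) :
    dform e₁ e₃ i u = inner ℝ (localGrad x b u) (e₂ u) * dform x e₁ i u
      - inner ℝ (localGrad x b u) (e₁ u) * dform x e₂ i u - dform x e₂ i u := by
  have hA := h.toIsAdaptedFrameOn
  have hJ := hA.wedge_coframe_ne_zero hu
  have hs := hA.wedge_second_form hu
  have hm := hA.wedge_mul_localMeanCurvature hu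
  rw [h.minimal u hu, mul_zero] at hm
  have hm' : wedge (dform e₁ e₃ · u) (dform x e₂ · u)
      - wedge (dform e₂ e₃ · u) (dform x e₁ · u) = 0 := by linarith
  simp only [wedge, h.conn_second_third hu, hA.pd_eq_coframe hu b] at hs hm'
  refine mul_left_cancel₀ hJ ?_
  simp only [wedge]
  fin_cases i
  · simp only [Fin.zero_eta]
    linear_combination dform x e₁ 0 u * hm' - dform x e₂ 0 u * hs
  · simp only [Fin.mk_one]
    linear_combination dform x e₁ 1 u * hm' - dform x e₂ 1 u * hs

theorem norm_localGrad_add_sq (k : ℝ) :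
    ‖localGrad x b u + k • e₁ u‖ ^ 2 =
      (inner ℝ (localGrad x b u) (e₁ u) + k) ^ 2 + inner ℝ (localGrad x b u) (e₂ u) ^ 2 := by
  have hA := h.toIsAdaptedFrameOn
  obtain ⟨g3, g4⟩ := hA.inner_localGrad_normal hu b
  have a1 : inner ℝ (e₁ u) (e₁ u) = 1 := by simpa using hA.inner_frame 0 0 u hu
  have a2 : inner ℝ (e₁ u) (e₂ u) = 0 := by simpa using hA.inner_frame 0 1 u hu
  have a3 : inner ℝ (e₁ u) (e₃ u) = 0 := by simpa using hA.inner_frame 0 2 u hu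
  have a4 : inner ℝ (e₁ u) (x u) = 0 := by simpa using hA.inner_frame 0 3 u hu
  rw [← real_inner_self_eq_norm_sq, hA.inner_eq hu]
  simp only [inner_add_left, real_inner_smul_left, a1, a2, a3, a4, g3, g4]
  ring

theorem localGaussCurvature_eq_one_sub :
    localGaussCurvature x u = 1 - ‖localGrad x b u + e₁ u‖ ^ 2 := by
  have hA := h.toIsAdaptedFrameOn
  have hJ := hA.wedge_coframe_ne_zero hu
  have hw : wedge (dform e₁ e₃ · u) (dform e₂ e₃ · u) =
      -‖localGrad x b u + e₁ u‖ ^ 2 * wedge (dform x e₁ · u) (dform x e₂ · u) := by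
    have := h.norm_localGrad_add_sq hu 1
    rw [one_smul] at this
    rw [this]
    simp only [wedge, h.conn_first_third hu, h.conn_second_third hu, hA.pd_eq_coframe hu b]
    ring
  rw [hA.localGaussCurvature_eq hu, hw, mul_div_cancel_right₀ _ hJ]
  ring

theorem localLaplacian_eq (hc : Real.cos (b u) ≠ 0) :
    localLaplacian x b u = -Real.tan (b u) * ‖localGrad x b u + (2 : ℝ) • e₁ u‖ ^ 2 := by
  have hA := h.toIsAdaptedFrameOn
  have hJ := hA.wedge_coframe_ne_zero hu
  have hs : ∀ i, ∀ w ∈ U, -(dform x e₂ i w + dform e₁ e₃ i w) =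
      inner ℝ (localGrad x b w) (e₁ w) * dform x e₂ i w
        - inner ℝ (localGrad x b w) (e₂ w) * dform x e₁ i w := by
    intro i w hw
    rw [h.conn_first_third hw]
    ring
  have hL := hA.wedge_mul_localLaplacian hu (h.smooth_angle u hu)
    (s := fun i w => -(dform x e₂ i w + dform e₁ e₃ i w)) hs
  have dθ : ∀ i, DifferentiableAt ℝ (dform x e₂ i) u := fun i =>
    differentiableAt_of_contDiffAt
      ((contDiffAt_pd (h.smooth u hu) i).inner ℝ (h.smooth₂ u hu))
  have dconn : ∀ i, DifferentiableAt ℝ (dform e₁ e₃ i) u := fun i =>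
    differentiableAt_of_contDiffAt
      ((contDiffAt_pd (h.smooth₁ u hu) i).inner ℝ (h.smooth₃ u hu))
  have c1 := hA.pd_coframe_sub hu
  have c2 := hA.pd_connection_sub hu
  simp only [pd_neg, pd_add (dθ _) (dconn _)] at hL
  -- `ω₁₂ = tan b (⋆db + 2 θ₂)`
  have conn12 : ∀ i, dform e₁ e₂ i u = Real.tan (b u) *
      (inner ℝ (localGrad x b u) (e₁ u) * dform x e₂ i u
        - inner ℝ (localGrad x b u) (e₂ u) * dform x e₁ i u + 2 * dform x e₂ i u) := by
    intro i
    have := h.conn_first_reeb hu i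
    rw [h.conn_first_third hu] at this
    rw [Real.tan_eq_sin_div_cos]
    field_simp
    linear_combination this
  refine mul_left_cancel₀ hJ ?_
  rw [h.norm_localGrad_add_sq hu]
  simp only [wedge, conn12, h.conn_second_third hu, hA.pd_eq_coframe hu b] at c1 c2 hL ⊢
  linear_combination hL - c1 - c2

end IsMinimalContactFrameOn

/-! ### Passing to a chart -/

section Chart

variable {S : Type*} [TopologicalSpace S] [ChartedSpace Plane S]
  {c : OpenPartialHomeomorph S Plane} (hc : c ∈ IsManifold.maximalAtlas (𝓡 2) ∞ S)

include hc

theorem mdifferentiable_of_mem_maximalAtlas : c.MDifferentiable (𝓡 2) (𝓡 2) :=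
  ⟨(contMDiffOn_of_mem_maximalAtlas hc).mdifferentiableOn (by simp),
    (contMDiffOn_symm_of_mem_maximalAtlas hc).mdifferentiableOn (by simp)⟩

variable {F : Type*} [NormedAddCommGroup F] [NormedSpace ℝ F] {u : Plane} (hu : u ∈ c.target)

include hu

theorem contDiffAt_comp_symm {f : S → F} (hf : ContMDiffAt (𝓡 2) 𝓘(ℝ, F) ∞ f (c.symm u)) :
    ContDiffAt ℝ ∞ (f ∘ c.symm) u :=
  (hf.comp u (contMDiffAt_symm_of_mem_maximalAtlas hc hu)).contDiffAt

theorem mfderiv_symm_bijective : Function.Bijective (mfderiv (𝓡 2) (𝓡 2) c.symm u) :=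
  (mdifferentiable_of_mem_maximalAtlas hc).symm.mfderiv_bijective hu

theorem fderiv_comp_symm {f : S → F} (hf : ContMDiffAt (𝓡 2) 𝓘(ℝ, F) ∞ f (c.symm u)) (v : Plane) :
    fderiv ℝ (f ∘ c.symm) u v =
      mfderiv (𝓡 2) 𝓘(ℝ, F) f (c.symm u) (mfderiv (𝓡 2) (𝓡 2) c.symm u v) := by
  rw [← mfderiv_eq_fderiv, mfderiv_comp (I' := 𝓡 2) u (hf.mdifferentiableAt (by simp))
    ((mdifferentiable_of_mem_maximalAtlas hc).mdifferentiableAt_symm hu)]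
  rfl

theorem tangentPlane_eq_range_fderiv {φ : S → C2} (hφ : IsSphereImmersion φ) :
    tangentPlane φ (c.symm u) = Set.range (fderiv ℝ (φ ∘ c.symm) u) := by
  ext t
  constructor
  · rintro ⟨v, rfl⟩
    obtain ⟨w, rfl⟩ := (mfderiv_symm_bijective hc hu).2 v
    exact ⟨w, fderiv_comp_symm hc hu (hφ.smooth _) w⟩
  · rintro ⟨w, rfl⟩
    exact ⟨_, (fderiv_comp_symm hc hu (hφ.smooth _) w).symm⟩

theorem fderiv_comp_symm_injective {φ : S → C2} (hφ : IsSphereImmersion φ) :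
    Function.Injective (fderiv ℝ (φ ∘ c.symm) u) := by
  intro v w hvw
  rw [fderiv_comp_symm hc hu (hφ.smooth _), fderiv_comp_symm hc hu (hφ.smooth _)] at hvw
  exact (mfderiv_symm_bijective hc hu).1 (hφ.injective_mfderiv _ hvw)

end Chart

theorem linearIndependent_pd {x : Plane → C2} {u : Plane}
    (hx : Function.Injective (fderiv ℝ x u)) : LinearIndependent ℝ fun i => pd i x u := by
  rw [Fintype.linearIndependent_iff]
  intro a ha
  have h0 : fderiv ℝ x u (WithLp.toLp 2 a) = fderiv ℝ x u 0 := by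
    rw [map_zero, fderiv_apply_eq_pd, ← ha, Fin.sum_univ_two]
  intro i
  have := congrArg (fun v : Plane => v i) (hx h0)
  simpa using this

/-- An orthonormal pair in the range of the differential spans the tangent plane, so that a vector
orthogonal to the pair is orthogonal to the surface. -/
theorem inner_fderiv_eq_zero {x : Plane → C2} {u : Plane}
    (hx : Function.Injective (fderiv ℝ x u)) {a b ν : C2} (hab : Orthonormal ℝ ![a, b])
    (ha : a ∈ Set.range (fderiv ℝ x u)) (hb : b ∈ Set.range (fderiv ℝ x u))
    (haν : inner ℝ a ν = 0) (hbν : inner ℝ b ν = 0) (v : Plane) :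
    inner ℝ (fderiv ℝ x u v) ν = 0 := by
  let T : Submodule ℝ C2 := LinearMap.range (fderiv ℝ x u : Plane →ₗ[ℝ] C2)
  have hT : Module.finrank ℝ T = 2 := by
    rw [LinearMap.finrank_range_of_inj hx]; simp
  have hs : Submodule.span ℝ (Set.range ![a, b]) = T := by
    refine Submodule.eq_of_le_of_finrank_le ?_ ?_
    · rw [Submodule.span_le]
      rintro _ ⟨i, rfl⟩
      fin_cases i
      exacts [ha, hb]
    · rw [hT, finrank_span_eq_card hab.linearIndependent]; simp
  have hv : fderiv ℝ x u v ∈ Submodule.span ℝ ({a, b} : Set C2) := by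
    have : fderiv ℝ x u v ∈ T := ⟨v, rfl⟩
    rwa [← hs, Matrix.range_cons_cons_empty] at this
  obtain ⟨s, t, hst⟩ := Submodule.mem_span_pair.1 hv
  rw [← hst, inner_add_left, real_inner_smul_left, real_inner_smul_left, haν, hbν]
  ring

/-- A unit vector `a` and a unit vector `z`, orthogonal over `ℂ`, together with the rotation by
an angle `t` of `(i a, i z)`, form an orthonormal basis of `ℂ²` over `ℝ`. -/
theorem orthonormal_contact_frame {z a : C2} (hz : ‖z‖ = 1) (ha : ‖a‖ = 1)
    (haz : a ∈ contactDistribution z) (t : ℝ) :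
    Orthonormal ℝ ![a, Real.sin t • (Complex.I • a) + Real.cos t • (Complex.I • z),
      -Real.cos t • (Complex.I • a) + Real.sin t • (Complex.I • z), z] := by
  obtain ⟨h1, h2⟩ := haz
  have zz : inner ℝ z z = 1 := by rw [real_inner_self_eq_norm_sq, hz, one_pow]
  have aa : inner ℝ a a = 1 := by rw [real_inner_self_eq_norm_sq, ha, one_pow]
  have az : inner ℝ a z = 0 := by rw [real_inner_comm, h1]
  have az' : inner ℝ a (Complex.I • z) = 0 := by rw [real_inner_comm]; exact h2
  have za' : inner ℝ (Complex.I • z) a = 0 := h2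
  have za'' : inner ℝ z (Complex.I • a) = 0 := by rw [← neg_eq_zero, ← inner_I_smul_left, za']
  have az'' : inner ℝ (Complex.I • a) z = 0 := by rw [inner_I_smul_left, az', neg_zero]
  have zz' : inner ℝ (Complex.I • z) z = 0 := by rw [real_inner_comm, inner_I_smul_self]
  have aa' : inner ℝ (Complex.I • a) a = 0 := by rw [real_inner_comm, inner_I_smul_self]
  have hsc := Real.sin_sq_add_cos_sq t
  rw [orthonormal_iff_ite]
  intro i j
  fin_cases i <;> fin_cases j <;>
    simp [inner_add_left, inner_add_right, real_inner_smul_left, real_inner_smul_right,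
      inner_I_smul_I_smul, inner_I_smul_self, zz, aa, az, az', za', za'', az'', zz', aa', h1,
      -inner_self_eq_norm_sq_to_K] <;> linarith

/-- In any chart, the given data are an adapted frame of a minimal surface with contact angle. -/
theorem isMinimalContactFrameOn_of_chart {S : Type*} [TopologicalSpace S] [ChartedSpace Plane S]
    {φ : S → C2} (hφ : IsSphereImmersion φ) (hmin : IsMinimal φ)
    {W : Set S} (hW : IsOpen W) {e₁ e₂ : S → C2} {β : S → ℝ}
    (hframe : IsContactFrameOn φ e₁ e₂ β W) {c : OpenPartialHomeomorph S Plane}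
    (hc : c ∈ IsManifold.maximalAtlas (𝓡 2) ∞ S) :
    IsMinimalContactFrameOn (φ ∘ c.symm) (e₁ ∘ c.symm) (e₂ ∘ c.symm)
      (fun u => -Real.cos (β (c.symm u)) • (Complex.I • e₁ (c.symm u))
        + Real.sin (β (c.symm u)) • (Complex.I • φ (c.symm u)))
      (β ∘ c.symm) (c.target ∩ c.symm ⁻¹' W) := by
  set x := φ ∘ c.symm
  set e₃ : Plane → C2 := fun u => -Real.cos (β (c.symm u)) • (Complex.I • e₁ (c.symm u))
        + Real.sin (β (c.symm u)) • (Complex.I • φ (c.symm u))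
  have hx : ∀ u ∈ c.target ∩ c.symm ⁻¹' W, ContDiffAt ℝ ∞ x u := fun u hu =>
    contDiffAt_comp_symm hc hu.1 (hφ.smooth _)
  have h1 : ∀ u ∈ c.target ∩ c.symm ⁻¹' W, ContDiffAt ℝ ∞ (e₁ ∘ c.symm) u := fun u hu =>
    contDiffAt_comp_symm hc hu.1 (hframe.smooth_field.contMDiffAt (hW.mem_nhds hu.2))
  have hb : ∀ u ∈ c.target ∩ c.symm ⁻¹' W, ContDiffAt ℝ ∞ (β ∘ c.symm) u := fun u hu =>
    contDiffAt_comp_symm hc hu.1 (hframe.smooth_angle.contMDiffAt (hW.mem_nhds hu.2))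
  have hU : IsOpen (c.target ∩ c.symm ⁻¹' W) := c.isOpen_inter_preimage_symm hW
  have hI : ∀ {f : Plane → C2} {u : Plane}, ContDiffAt ℝ ∞ f u →
      ContDiffAt ℝ ∞ (fun w => Complex.I • f w) u := fun hf => hf.const_smul Complex.I
  have h2 : ∀ u ∈ c.target ∩ c.symm ⁻¹' W, (e₂ ∘ c.symm) u =
      Real.sin ((β ∘ c.symm) u) • (Complex.I • (e₁ ∘ c.symm) u)
        + Real.cos ((β ∘ c.symm) u) • (Complex.I • x u) := fun u hu => hframe.second_eq _ hu.2
  have ho : ∀ u ∈ c.target ∩ c.symm ⁻¹' W,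
      Orthonormal ℝ ![(e₁ ∘ c.symm) u, (e₂ ∘ c.symm) u, e₃ u, x u] := by
    intro u hu
    rw [h2 u hu]
    exact orthonormal_contact_frame (by simpa using hφ.mem_sphere (c.symm u))
      (hframe.norm_field _ hu.2) (hframe.field_contact _ hu.2) _
  have hn : ∀ u ∈ c.target ∩ c.symm ⁻¹' W, ∀ v, inner ℝ (fderiv ℝ x u v) (e₃ u) = 0 := by
    intro u hu
    have hT := tangentPlane_eq_range_fderiv hc hu.1 hφ
    have hij := orthonormal_iff_ite.1 (ho u hu)
    have hab : Orthonormal ℝ ![(e₁ ∘ c.symm) u, (e₂ ∘ c.symm) u] := by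
      have := (ho u hu).comp ![0, 1] (by decide)
      convert this using 1
      ext i; fin_cases i <;> rfl
    exact inner_fderiv_eq_zero (fderiv_comp_symm_injective hc hu.1 hφ) hab
      (hT ▸ hframe.field_tangent _ hu.2) (hT ▸ hframe.second_tangent _ hu.2)
      (by simpa using hij 0 2) (by simpa using hij 1 2)
  refine ⟨⟨hU, hx, h1, ?_, ?_, ho, fun u hu i => hn u hu _, ?_⟩, hb, h2, fun u _ => rfl, ?_⟩
  · intro u hu
    refine ContDiffAt.congr_of_eventuallyEq ?_ (Filter.eventually_of_mem (hU.mem_nhds hu) h2)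
    exact ((hb u hu).sin.smul (hI (h1 u hu))).add ((hb u hu).cos.smul (hI (hx u hu)))
  · intro u hu
    exact ((hb u hu).cos.neg.smul (hI (h1 u hu))).add ((hb u hu).sin.smul (hI (hx u hu)))
  · intro u hu
    exact Matrix.det_gram_ne_zero_iff_linearIndependent.2
      (linearIndependent_pd (fderiv_comp_symm_injective hc hu.1 hφ))
  · intro u hu
    have := hmin c hc (c.symm u) (c.map_target hu.1) (e₃ u)
      (show inner ℝ (x u) (e₃ u) = 0 by simpa using orthonormal_iff_ite.1 (ho u hu) 3 2) (by
        rw [tangentPlane_eq_range_fderiv hc hu.1 hφ]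
        rintro _ ⟨v, rfl⟩
        exact hn u hu v)
    rwa [c.right_inv hu.1] at this

end ContactSurface

end

theorem mainTheorem4 {S : Type*} [TopologicalSpace S] [ChartedSpace ContactSurface.Plane S]
    [IsManifold (𝓡 2) ∞ S]
    (φ : S → ContactSurface.C2) (hφ : ContactSurface.IsSphereImmersion φ)
    (hmin : ContactSurface.IsMinimal φ)
    (W : Set S) (hW : IsOpen W) (e₁ e₂ : S → ContactSurface.C2) (β : S → ℝ)
    (hframe : ContactSurface.IsContactFrameOn φ e₁ e₂ β W)
    (p : S) (hp : p ∈ W)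
    (c : OpenPartialHomeomorph S ContactSurface.Plane)
    (hc : c ∈ IsManifold.maximalAtlas (𝓡 2) ∞ S) (hpc : p ∈ c.source) :
    ContactSurface.gaussCurvature φ c p
        = 1 - ‖ContactSurface.grad φ c β p + e₁ p‖ ^ 2 ∧
    (Real.cos (β p) ≠ 0 →
      ContactSurface.laplacian φ c β p
          = -Real.tan (β p) * ‖ContactSurface.grad φ c β p + (2 : ℝ) • e₁ p‖ ^ 2 ∧
      ∀ v₁ v₂ : TangentSpace (𝓡 2) p,
        mfderiv (𝓡 2) 𝓘(ℝ, ContactSurface.C2) φ p v₁ = e₁ p →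
        mfderiv (𝓡 2) 𝓘(ℝ, ContactSurface.C2) φ p v₂ = e₂ p →
        ContactSurface.laplacian φ c β p
          = -Real.tan (β p) *
              ((ContactSurface.differential β p v₁ + 2) ^ 2
                + ContactSurface.differential β p v₂ ^ 2)) := by
  have hF := ContactSurface.isMinimalContactFrameOn_of_chart hφ hmin hW hframe hc
  obtain ⟨u, hu, rfl⟩ : ∃ u ∈ c.target, c.symm u = p :=
    ⟨c p, c.map_source hpc, c.left_inv hpc⟩
  have huW : u ∈ c.target ∩ c.symm ⁻¹' W := ⟨hu, hp⟩
  have hA := hF.toIsAdaptedFrameOn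
  simp only [ContactSurface.gaussCurvature, ContactSurface.grad, ContactSurface.laplacian,
    c.right_inv hu]
  refine ⟨hF.localGaussCurvature_eq_one_sub huW, fun hcos =>
    ⟨hF.localLaplacian_eq huW hcos, fun v₁ v₂ hv₁ hv₂ => ?_⟩⟩
  have key : ∀ (e : ContactSurface.C2) (v : TangentSpace (𝓡 2) (c.symm u)),
      mfderiv (𝓡 2) 𝓘(ℝ, ContactSurface.C2) φ (c.symm u) v = e →
      ContactSurface.differential β (c.symm u) v =
        inner ℝ (ContactSurface.localGrad (φ ∘ c.symm) (β ∘ c.symm) u) e := by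
    intro e v hv
    obtain ⟨w, rfl⟩ := (ContactSurface.mfderiv_symm_bijective hc hu).2 v
    have hw : fderiv ℝ (φ ∘ c.symm) u w = e :=
      (ContactSurface.fderiv_comp_symm hc hu (hφ.smooth _) w).trans hv
    rw [← hw]
    exact (ContactSurface.fderiv_comp_symm hc hu
      (hframe.smooth_angle.contMDiffAt (hW.mem_nhds hp)) w).symm.trans
      (hA.inner_localGrad_fderiv huW (β ∘ c.symm) w).symm
  rw [key _ v₁ hv₁, key _ v₂ hv₂, hF.localLaplacian_eq huW hcos]
  exact congrArg _ (hF.norm_localGrad_add_sq huW 2)
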